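/- Let $H$ be an infinite-dimensional real separable Hilbert space. A dictionary in $H$ is a set ${\cal D}\subset H$ of unit vectors whose closed linear span is $H$; its cumulative coherence is $$\mu_1({\cal D}):=\sup_{g\in{\cal D}}\ \sum_{\tilde g\in{\cal D},\ \tilde g\neq g}|\langle\tilde g,g\rangle|\in[0,\infty].$$ A realization of the Pure Greedy Algorithm (PGA) for $f\in H$ with respect to ${\cal D}$ is given by $G_0:=0$, $f_0:=f$ and, for every $m\ge 0$, the choice of an element $g_{m+1}\in{\cal D}$ with $|\langle f_m,g_{m+1}\rangle|=\sup_{g\in{\cal D}}|\langle f_m,g\rangle|$, followed by $G_{m+1}:=G_m+\langle f_m,g_{m+1}\rangle g_{m+1}$ and $f_{m+1}:=f-G_{m+1}$; one writes $G_m^{PGA}(f,{\cal D}):=G_m$. Then there exist a dictionary ${\cal D}$ in $H$ with $\mu_1({\cal D})<\infty$, a finite linear combination $f_0$ of elements of ${\cal D}$, and constants $\beta>0$ and $C>0$ such that the PGA for $f_0$ with respect to ${\cal D}$ has a realization, and every realization satisfies $$\|f_0-G_m^{PGA}(f_0,{\cal D})\|\ \ge\ C\,m^{-1/2+\beta}\qquad\text{for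 all } m\ge 1 .$$ -/

import Mathlib

open scoped ENNReal

/-- A dictionary in a real inner product space: a set of unit vectors whose linear span is dense. -/
structure IsDictionary {H : Type*} [NormedAddCommGroup H] [InnerProductSpace ℝ H]
    (D : Set H) : Prop where
  norm_eq_one : ∀ g ∈ D, ‖g‖ = 1
  dense_span : (Submodule.span ℝ D).topologicalClosure = ⊤

/-- The cumulative coherence `μ₁(D) = sup_{g ∈ D} ∑_{g' ∈ D, g' ≠ g} |⟨g', g⟩|`,
as an extended nonnegative real number. -/
noncomputable def cumulativeCoherence {H : Type*} [NormedAddCommGroup H] [InnerProductSpace ℝ H]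
    (D : Set H) : ℝ≥0∞ :=
  ⨆ g ∈ D, ∑' g' : {x : H // x ∈ D ∧ x ≠ g}, ENNReal.ofReal |inner ℝ (g' : H) g|

/-- The class `A₀(D)` of finite linear combinations of elements of `D`. -/
def finiteCombinations {H : Type*} [NormedAddCommGroup H] [InnerProductSpace ℝ H]
    (D : Set H) : Set H :=
  (Submodule.span ℝ D : Set H)

/-- The approximants `G_m` of the Pure Greedy Algorithm applied to `f`, when `g m` is the
element selected at step `m + 1`. The residual after `m` steps is `f - pgaApprox f g m`. -/
noncomputable def pgaApprox {H : Type*} [NormedAddCommGroup H] [InnerProductSpace ℝ H]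
    (f : H) (g : ℕ → H) : ℕ → H
  | 0 => 0
  | m + 1 => pgaApprox f g m + (inner ℝ (f - pgaApprox f g m) (g m) : ℝ) • g m

/-- `g` is an admissible sequence of choices of the Pure Greedy Algorithm for `f` with respect
to `D`: `g m` is an element of `D` at which `sup_{h ∈ D} |⟨f_m, h⟩|` is attained, where
`f_m = f - G_m` is the residual after `m` steps. -/
def IsPGASelection {H : Type*} [NormedAddCommGroup H] [InnerProductSpace ℝ H]
    (D : Set H) (f : H) (g : ℕ → H) : Prop :=
  ∀ m : ℕ, g m ∈ D ∧
    ∀ h ∈ D, |inner ℝ (f - pgaApprox f g m) h| ≤ |inner ℝ (f - pgaApprox f g m) (g m)|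

/-!
The dictionary consists of levels, the `l`-th being `4 ^ l` orthonormal elements with sum
`2 ^ l • U l`, where `U l` is a unit vector. The residual runs through `ρ ^ l • w l`, where
`w l = U l + ρ • w (l + 1)` and `U l` is orthogonal to `w (l + 1)`. Each element of level `l` has
inner product `2 ^ (-l)` with `w l`, more than any other dictionary element, and it keeps this
lead until it is selected: the other elements of its level are orthogonal to it, and elsewhere the
residual interpolates between `w l` and `ρ • w (l + 1)`. So the algorithm removes level `l`
completely, in arbitrary order, and goes on to level `l + 1`. After about `4 ^ l` steps the
residual has norm about `ρ ^ l`, so the decay is slower than `t ^ (-1 / 2)` as soon as `1 / 2 < ρ`.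

Such a `w` is stationary with lag-one correlation equal to `ρ * ‖w l‖ ^ 2`. The moving average of
an orthonormal sequence with weights `5, 3, 1` achieves `ρ = 18 / 35` and is uncorrelated beyond lag
two. Levels far apart are therefore orthogonal, which keeps the cumulative coherence finite. The
starting vector `w 0` is a finite combination thanks to two extra elements of the dictionary that
are never selected.
-/

section Greedy

variable {H : Type*} [NormedAddCommGroup H] [InnerProductSpace ℝ H] {D : Set H}

/-- `x` is an admissible choice of the Pure Greedy Algorithm with dictionary `D` for the
residual `r`. -/
def IsGreedyChoice (D : Set H) (r x : H) : Prop :=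
  x ∈ D ∧ ∀ y ∈ D, |inner ℝ r y| ≤ |inner ℝ r x|

lemma isGreedyChoice_smul_iff {c : ℝ} (hc : c ≠ 0) {r x : H} :
    IsGreedyChoice D (c • r) x ↔ IsGreedyChoice D r x := by
  simp only [IsGreedyChoice, real_inner_smul_left, abs_mul, mul_le_mul_iff_right₀ (abs_pos.2 hc)]

lemma sub_pgaApprox_succ (f : H) (g : ℕ → H) (t : ℕ) :
    f - pgaApprox f g (t + 1) =
      f - pgaApprox f g t - (inner ℝ (f - pgaApprox f g t) (g t) : ℝ) • g t :=
  sub_add_eq_sub_sub _ _ _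

lemma IsPGASelection.residual_induction {f : H} {g : ℕ → H} (hg : IsPGASelection D f g)
    {P : ℕ → H → Prop} (zero : P 0 f)
    (succ : ∀ t r x, P t r → IsGreedyChoice D r x → P (t + 1) (r - (inner ℝ r x : ℝ) • x))
    (t : ℕ) : P t (f - pgaApprox f g t) := by
  induction t with
  | zero => simpa [pgaApprox] using zero
  | succ t ih => rw [sub_pgaApprox_succ]; exact succ t _ _ ih (hg t)

lemma exists_isPGASelection_of_invariant {f : H} {P : ℕ → H → Prop} (zero : P 0 f)
    (succ : ∀ t r x, P t r → IsGreedyChoice D r x → P (t + 1) (r - (inner ℝ r x : ℝ) • x))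
    (exists_choice : ∀ t r, P t r → ∃ x, IsGreedyChoice D r x) :
    ∃ g : ℕ → H, IsPGASelection D f g := by
  choose! pick hpick using exists_choice
  let residual : ℕ → H := Nat.rec f fun t r => r - (inner ℝ r (pick t r) : ℝ) • pick t r
  have residual_mem : ∀ t, P t (residual t) := fun t => by
    induction t with
    | zero => exact zero
    | succ t ih => exact succ t _ _ ih (hpick t _ ih)
  let g : ℕ → H := fun t => pick t (residual t)
  have residual_eq : ∀ t, f - pgaApprox f g t = residual t := fun t => by
    induction t with
    | zero => exact sub_zero f
    | succ t ih => rw [sub_pgaApprox_succ, ih]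
  refine ⟨g, fun t => ?_⟩
  rw [residual_eq]
  exact hpick t _ (residual_mem t)

end Greedy

section PowersOfFour

lemma four_pow_eq_two_pow_sq (m : ℕ) : (4 ^ m : ℝ) = (2 ^ m) ^ 2 := by
  rw [← pow_mul, mul_comm, pow_mul]
  norm_num

lemma mul_rpow_logb_le {ρ x : ℝ} {m : ℕ} (hρ : 0 < ρ) (hρ' : ρ ≤ 1) (h : 4 ^ m ≤ 4 * x) :
    ρ * x ^ Real.logb 4 ρ ≤ ρ ^ m := by
  have hx : 0 ≤ x := by linarith [pow_pos (four_pos (α := ℝ)) m]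
  have h4 : (4 : ℝ) ^ Real.logb 4 ρ = ρ := Real.rpow_logb (by norm_num) (by norm_num) hρ
  calc ρ * x ^ Real.logb 4 ρ = (4 * x) ^ Real.logb 4 ρ := by
        rw [Real.mul_rpow (by norm_num) hx, h4]
    _ ≤ ((4 : ℝ) ^ m) ^ Real.logb 4 ρ :=
        Real.rpow_le_rpow_of_nonpos (by positivity) h
          (Real.logb_nonpos (by norm_num) hρ.le hρ')
    _ = ρ ^ m := by rw [← Real.rpow_natCast_mul (by norm_num), mul_comm,
        Real.rpow_mul_natCast (by norm_num), h4]

lemma neg_half_lt_logb_four {ρ : ℝ} (hρ : 1 / 2 < ρ) : -(1 / 2 : ℝ) < Real.logb 4 ρ := by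
  rw [Real.lt_logb_iff_rpow_lt (by norm_num) (by linarith), Real.rpow_neg (by norm_num),
    ← Real.sqrt_eq_rpow, show (4 : ℝ) = 2 ^ 2 by norm_num, Real.sqrt_sq (by norm_num)]
  linarith

end PowersOfFour

section Cascade

variable {H : Type*} [NormedAddCommGroup H] [InnerProductSpace ℝ H]

/-- The vector that the whole `l`-th level of a cascade with leading vectors `w` and ratio `ρ`
removes from `w l`. -/
def direction (ρ : ℝ) (w : ℕ → H) (l : ℕ) : H := w l - ρ • w (l + 1)

/-- A greedy cascade: `D` contains orthonormal levels `g l` of `4 ^ l` elements such that, for the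
residual `w l`, the greedy choices are exactly the elements of level `l`, and removing all of them
leaves the residual `ρ • w (l + 1)`. All other elements of `D` have the same inner product with each
element of level `l`, so that the order of selection within a level does not matter. -/
structure IsGreedyCascade (D : Set H) (ρ : ℝ) (w : ℕ → H) (g : ∀ l : ℕ, Fin (4 ^ l) → H) :
    Prop where
  ratio_pos : 0 < ρ
  ratio_le_one : ρ ≤ 1
  mem : ∀ l i, g l i ∈ D
  orthonormal : ∀ l, Orthonormal ℝ (g l)
  sum_eq : ∀ l, ∑ i, g l i = (2 ^ l : ℝ) • direction ρ w l
  inner_leading : ∀ l i, inner ℝ (w l) (g l i) = (2 ^ l : ℝ)⁻¹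
  inner_eq : ∀ l, ∀ x ∈ D, x ∉ Set.range (g l) → ∀ i,
    inner ℝ (g l i) x = (2 ^ l : ℝ)⁻¹ * inner ℝ (direction ρ w l) x
  abs_inner_lt : ∀ l, ∀ x ∈ D, x ∉ Set.range (g l) → |inner ℝ (w l) x| < (2 ^ l : ℝ)⁻¹

/-- The residual of `w m` once the elements of level `m` with index in `S` have been selected. -/
noncomputable def levelResidual (w : ℕ → H) (g : ∀ l : ℕ, Fin (4 ^ l) → H) (m : ℕ)
    (S : Finset (Fin (4 ^ m))) : H :=
  w m - (2 ^ m : ℝ)⁻¹ • ∑ i ∈ S, g m i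

/-- `r` is a residual that `t` greedy steps of a cascade can produce: all levels below some `m`
are used up, and so are the elements of level `m` with index in `S`. Taking `S` proper makes the
level `m` unique. -/
def IsCascadeResidual (ρ : ℝ) (w : ℕ → H) (g : ∀ l : ℕ, Fin (4 ^ l) → H) (t : ℕ) (r : H) : Prop :=
  ∃ (m : ℕ) (S : Finset (Fin (4 ^ m))), S ≠ Finset.univ ∧
    ∑ l ∈ Finset.range m, 4 ^ l + S.card = t ∧ r = ρ ^ m • levelResidual w g m S

lemma levelResidual_empty (w : ℕ → H) (g : ∀ l : ℕ, Fin (4 ^ l) → H) (m : ℕ) :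
    levelResidual w g m ∅ = w m := by
  simp [levelResidual]

lemma levelResidual_insert (w : ℕ → H) (g : ∀ l : ℕ, Fin (4 ^ l) → H) {m : ℕ}
    {S : Finset (Fin (4 ^ m))} {i : Fin (4 ^ m)} (hi : i ∉ S) :
    levelResidual w g m (insert i S) = levelResidual w g m S - (2 ^ m : ℝ)⁻¹ • g m i := by
  rw [levelResidual, levelResidual, Finset.sum_insert hi, smul_add]
  abel

lemma isCascadeResidual_zero (ρ : ℝ) (w : ℕ → H) (g : ∀ l : ℕ, Fin (4 ^ l) → H) :
    IsCascadeResidual ρ w g 0 (w 0) :=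
  ⟨0, ∅, Finset.univ_nonempty.ne_empty.symm, rfl, by rw [pow_zero, one_smul, levelResidual_empty]⟩

namespace IsGreedyCascade

variable {D : Set H} {ρ : ℝ} {w : ℕ → H} {g : ∀ l : ℕ, Fin (4 ^ l) → H} {m : ℕ}
  {S : Finset (Fin (4 ^ m))}

lemma levelResidual_univ (h : IsGreedyCascade D ρ w g) (m : ℕ) :
    levelResidual w g m Finset.univ = ρ • levelResidual w g (m + 1) ∅ := by
  rw [levelResidual_empty, levelResidual, h.sum_eq, inv_smul_smul₀ (by positivity), direction,
    sub_sub_cancel]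

lemma inner_levelResidual_level (h : IsGreedyCascade D ρ w g) (i : Fin (4 ^ m)) :
    inner ℝ (levelResidual w g m S) (g m i) = if i ∈ S then 0 else (2 ^ m : ℝ)⁻¹ := by
  simp only [levelResidual, inner_sub_left, real_inner_smul_left, sum_inner, h.inner_leading,
    orthonormal_iff_ite.1 (h.orthonormal m), Finset.sum_ite_eq']
  split_ifs <;> ring

lemma abs_inner_le (h : IsGreedyCascade D ρ w g) {x : H} (hx : x ∈ D) :
    |inner ℝ (w m) x| ≤ (2 ^ m : ℝ)⁻¹ := by
  by_cases hxm : x ∈ Set.range (g m)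
  · obtain ⟨i, rfl⟩ := hxm
    rw [h.inner_leading, abs_of_pos (by positivity)]
  · exact (h.abs_inner_lt m x hx hxm).le

lemma inner_levelResidual_of_notMem (h : IsGreedyCascade D ρ w g) {x : H} (hx : x ∈ D)
    (hxm : x ∉ Set.range (g m)) :
    inner ℝ (levelResidual w g m S) x =
      (1 - S.card / 4 ^ m) * inner ℝ (w m) x + S.card / 4 ^ m * (ρ * inner ℝ (w (m + 1)) x) := by
  simp only [levelResidual, inner_sub_left, real_inner_smul_left, sum_inner, h.inner_eq m x hx hxm,
    Finset.sum_const, nsmul_eq_mul, direction, four_pow_eq_two_pow_sq]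
  field_simp
  ring

lemma abs_inner_levelResidual_lt (h : IsGreedyCascade D ρ w g) (hS : S ≠ Finset.univ) {x : H}
    (hx : x ∈ D) (hxm : x ∉ Set.range (g m)) :
    |inner ℝ (levelResidual w g m S) x| < (2 ^ m : ℝ)⁻¹ := by
  set θ : ℝ := S.card / 4 ^ m with hθ
  have hθ0 : 0 ≤ θ := by positivity
  have hθ1 : θ < 1 := (div_lt_one (by positivity)).2 <| by
    exact_mod_cast Fintype.card_fin (4 ^ m) ▸ (Finset.card_lt_iff_ne_univ S).2 hS
  have hm : |inner ℝ (w m) x| < (2 ^ m : ℝ)⁻¹ := h.abs_inner_lt m x hx hxm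
  have hm' : |ρ * inner ℝ (w (m + 1)) x| ≤ (2 ^ m : ℝ)⁻¹ :=
    calc |ρ * inner ℝ (w (m + 1)) x| = ρ * |inner ℝ (w (m + 1)) x| := by
          rw [abs_mul, abs_of_pos h.ratio_pos]
      _ ≤ 1 * (2 ^ (m + 1))⁻¹ := by gcongr; exacts [h.ratio_le_one, h.abs_inner_le hx]
      _ ≤ (2 ^ m)⁻¹ := by rw [one_mul]; gcongr <;> norm_num
  rw [h.inner_levelResidual_of_notMem hx hxm]
  calc |(1 - θ) * inner ℝ (w m) x + θ * (ρ * inner ℝ (w (m + 1)) x)|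
      ≤ (1 - θ) * |inner ℝ (w m) x| + θ * |ρ * inner ℝ (w (m + 1)) x| := by
        refine (abs_add_le _ _).trans_eq ?_
        rw [abs_mul, abs_mul, abs_of_pos (sub_pos.2 hθ1), abs_of_nonneg hθ0]
    _ < (1 - θ) * (2 ^ m)⁻¹ + θ * (2 ^ m)⁻¹ :=
        add_lt_add_of_lt_of_le (mul_lt_mul_of_pos_left hm (sub_pos.2 hθ1))
          (mul_le_mul_of_nonneg_left hm' hθ0)
    _ = (2 ^ m)⁻¹ := by ring

lemma isGreedyChoice_levelResidual_iff (h : IsGreedyCascade D ρ w g) (hS : S ≠ Finset.univ)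
    {x : H} : IsGreedyChoice D (levelResidual w g m S) x ↔ ∃ i ∉ S, g m i = x := by
  have abs_inner : ∀ i ∉ S, |inner ℝ (levelResidual w g m S) (g m i)| = (2 ^ m : ℝ)⁻¹ :=
    fun i hi => by rw [h.inner_levelResidual_level, if_neg hi, abs_of_pos (by positivity)]
  have abs_inner_lt : ∀ y ∈ D, (∀ i ∉ S, g m i ≠ y) →
      |inner ℝ (levelResidual w g m S) y| < (2 ^ m : ℝ)⁻¹ := fun y hy hyS => by
    by_cases hym : y ∈ Set.range (g m)
    · obtain ⟨i, rfl⟩ := hym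
      have hi : i ∈ S := by_contra fun hi => hyS i hi rfl
      rw [h.inner_levelResidual_level, if_pos hi, abs_zero]
      positivity
    · exact h.abs_inner_levelResidual_lt hS hy hym
  constructor
  · rintro ⟨hxD, hmax⟩
    obtain ⟨j, hj⟩ := not_forall.1 (mt Finset.eq_univ_iff_forall.2 hS)
    by_contra! hx
    exact (hmax _ (h.mem m j)).not_gt (abs_inner j hj ▸ abs_inner_lt x hxD hx)
  · rintro ⟨i, hi, rfl⟩
    refine ⟨h.mem m i, fun y hy => ?_⟩
    rw [abs_inner i hi]
    by_cases hyS : ∃ j ∉ S, g m j = y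
    · obtain ⟨j, hj, rfl⟩ := hyS
      exact (abs_inner j hj).le
    · push Not at hyS
      exact (abs_inner_lt y hy hyS).le

lemma isCascadeResidual_succ (h : IsGreedyCascade D ρ w g) {t : ℕ} {r x : H}
    (hr : IsCascadeResidual ρ w g t r) (hx : IsGreedyChoice D r x) :
    IsCascadeResidual ρ w g (t + 1) (r - (inner ℝ r x : ℝ) • x) := by
  obtain ⟨m, S, hS, rfl, rfl⟩ := hr
  rw [isGreedyChoice_smul_iff (pow_pos h.ratio_pos m).ne',
    h.isGreedyChoice_levelResidual_iff hS] at hx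
  obtain ⟨i, hi, rfl⟩ := hx
  have hnext : ρ ^ m • levelResidual w g m S -
      (inner ℝ (ρ ^ m • levelResidual w g m S) (g m i) : ℝ) • g m i =
        ρ ^ m • levelResidual w g m (insert i S) := by
    rw [levelResidual_insert w g hi, real_inner_smul_left, h.inner_levelResidual_level, if_neg hi,
      smul_sub, smul_smul]
  have hcard := Finset.card_insert_of_notMem hi
  by_cases hfull : insert i S = Finset.univ
  · refine ⟨m + 1, ∅, Finset.univ_nonempty.ne_empty.symm, ?_, ?_⟩
    · rw [hfull, Finset.card_univ, Fintype.card_fin] at hcard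
      rw [Finset.sum_range_succ, Finset.card_empty, add_zero, add_assoc, ← hcard]
    · rw [hnext, hfull, h.levelResidual_univ, smul_smul, ← pow_succ ρ m]
  · exact ⟨m, insert i S, hfull, by rw [hcard, add_assoc], hnext⟩

lemma exists_isPGASelection (h : IsGreedyCascade D ρ w g) :
    ∃ γ : ℕ → H, IsPGASelection D (w 0) γ := by
  refine exists_isPGASelection_of_invariant (isCascadeResidual_zero ρ w g)
    (fun t r x => h.isCascadeResidual_succ) ?_
  rintro t r ⟨m, S, hS, -, rfl⟩
  obtain ⟨i, hi⟩ := not_forall.1 (mt Finset.eq_univ_iff_forall.2 hS)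
  exact ⟨g m i, (isGreedyChoice_smul_iff (pow_pos h.ratio_pos m).ne').2
    ((h.isGreedyChoice_levelResidual_iff hS).2 ⟨i, hi, rfl⟩)⟩

lemma one_le_norm (h : IsGreedyCascade D ρ w g) (m : ℕ) : 1 ≤ ‖w m‖ := by
  have bessel : ∑ _i : Fin (4 ^ m), ((2 ^ m : ℝ)⁻¹) ^ 2 ≤ ‖w m‖ ^ 2 := by
    simpa [real_inner_comm, h.inner_leading] using
      (h.orthonormal m).sum_inner_products_le (w m) (s := Finset.univ)
  have total : ∑ _i : Fin (4 ^ m), ((2 ^ m : ℝ)⁻¹) ^ 2 = 1 := by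
    simp [four_pow_eq_two_pow_sq]
  exact (one_le_sq_iff₀ (norm_nonneg _)).1 (total ▸ bessel)

lemma inner_level_leading_succ (h : IsGreedyCascade D ρ w g) (i : Fin (4 ^ m)) :
    inner ℝ (g m i) (w (m + 1)) = 0 := by
  have inner_direction : (2 ^ m : ℝ) * inner ℝ (g m i) (direction ρ w m) = 1 := by
    rw [← real_inner_smul_right, ← h.sum_eq, inner_sum]
    simp [orthonormal_iff_ite.1 (h.orthonormal m)]
  have inner_leading : (2 ^ m : ℝ) * inner ℝ (g m i) (w m) = 1 := by
    rw [real_inner_comm, h.inner_leading, mul_inv_cancel₀ (by positivity)]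
  rw [direction, inner_sub_right, real_inner_smul_right, mul_sub, inner_leading,
    sub_eq_self] at inner_direction
  simpa [h.ratio_pos.ne'] using inner_direction

lemma ratio_le_norm_levelResidual (h : IsGreedyCascade D ρ w g) (m : ℕ)
    (S : Finset (Fin (4 ^ m))) : ρ ≤ ‖levelResidual w g m S‖ := by
  have direction_perp : inner ℝ (direction ρ w m) (w (m + 1)) = 0 := by
    have := congrArg (inner ℝ · (w (m + 1))) (h.sum_eq m)
    simpa [sum_inner, h.inner_level_leading_succ, real_inner_smul_left] using this
  have inner_eq : inner ℝ (levelResidual w g m S) (w (m + 1)) = ρ * ‖w (m + 1)‖ ^ 2 := by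
    rw [levelResidual, ← sub_add_cancel (w m) (ρ • w (m + 1)), ← direction]
    simp only [inner_sub_left, inner_add_left, real_inner_smul_left, sum_inner, direction_perp,
      h.inner_level_leading_succ, Finset.sum_const_zero, real_inner_self_eq_norm_sq]
    ring
  have one_le := h.one_le_norm (m + 1)
  have cauchy := real_inner_le_norm (levelResidual w g m S) (w (m + 1))
  rw [inner_eq, pow_two, ← mul_assoc] at cauchy
  calc ρ ≤ ρ * ‖w (m + 1)‖ := le_mul_of_one_le_right h.ratio_pos.le one_le
    _ ≤ ‖levelResidual w g m S‖ := le_of_mul_le_mul_right cauchy (by linarith)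

theorem rpow_le_norm_sub_pgaApprox (h : IsGreedyCascade D ρ w g) {γ : ℕ → H}
    (hγ : IsPGASelection D (w 0) γ) {t : ℕ} (ht : 1 ≤ t) :
    ρ ^ 2 * (t : ℝ) ^ Real.logb 4 ρ ≤ ‖w 0 - pgaApprox (w 0) γ t‖ := by
  obtain ⟨m, S, -, hcard, hr⟩ := hγ.residual_induction (isCascadeResidual_zero ρ w g)
    (fun t r x => h.isCascadeResidual_succ) t
  have hm : 4 ^ m ≤ 4 * t := by
    have := geom_sum_mul_add 3 m
    norm_num at this
    omega
  calc ρ ^ 2 * (t : ℝ) ^ Real.logb 4 ρ = ρ * (t : ℝ) ^ Real.logb 4 ρ * ρ := by ring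
    _ ≤ ρ ^ m * ‖levelResidual w g m S‖ :=
        mul_le_mul (mul_rpow_logb_le h.ratio_pos h.ratio_le_one (by exact_mod_cast hm))
          (h.ratio_le_norm_levelResidual m S) h.ratio_pos.le (pow_pos h.ratio_pos m).le
    _ = ‖w 0 - pgaApprox (w 0) γ t‖ := by
        rw [hr, norm_smul, Real.norm_of_nonneg (pow_pos h.ratio_pos m).le]

end IsGreedyCascade

end Cascade

section Orthonormal

variable {𝕜 H : Type*} [RCLike 𝕜] [NormedAddCommGroup H] [InnerProductSpace 𝕜 H] [CompleteSpace H]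

lemma exists_orthonormal_of_not_finiteDimensional (hH : ¬ FiniteDimensional 𝕜 H)
    (ι : Type*) [Countable ι] : ∃ e : ι → H, Orthonormal 𝕜 e := by
  obtain ⟨s, b, -⟩ := exists_hilbertBasis 𝕜 H
  have : Infinite s := not_finite_iff_infinite.1 fun hs => by
    have := Fintype.ofFinite s
    exact hH b.toOrthonormalBasis.toBasis.finiteDimensional_of_finite
  obtain ⟨φ, hφ⟩ := Countable.exists_injective_nat ι
  exact ⟨_, b.orthonormal.comp _ ((Infinite.natEmbedding s).injective.comp hφ)⟩

lemma exists_orthonormal_completion (A : Set H) :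
    ∃ B : Set H, Orthonormal 𝕜 ((↑) : B → H) ∧ (∀ x ∈ A, ∀ y ∈ B, inner 𝕜 x y = 0) ∧
      (Submodule.span 𝕜 (A ∪ B)).topologicalClosure = ⊤ := by
  obtain ⟨s, b, -⟩ := exists_hilbertBasis 𝕜 (Submodule.span 𝕜 A)ᗮ
  have orthonormal : Orthonormal 𝕜 fun i => (b i : H) :=
    b.orthonormal.comp_linearIsometry (Submodule.span 𝕜 A)ᗮ.subtypeₗᵢ
  refine ⟨Set.range fun i => (b i : H), orthonormal.toSubtypeRange, ?_, ?_⟩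
  · rintro x hx _ ⟨i, rfl⟩
    exact Submodule.inner_right_of_mem_orthogonal (Submodule.subset_span hx) (b i).2
  · rw [Submodule.topologicalClosure_eq_top_iff, Submodule.eq_bot_iff]
    intro x hx
    have hxA : x ∈ (Submodule.span 𝕜 A)ᗮ :=
      Submodule.orthogonal_le (Submodule.span_mono Set.subset_union_left) hx
    have repr_eq_zero : b.repr ⟨x, hxA⟩ = 0 := by
      ext i
      rw [b.repr_apply_apply, Submodule.coe_inner]
      exact Submodule.inner_right_of_mem_orthogonal (Submodule.subset_span (Or.inr ⟨i, rfl⟩)) hx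
    simpa using repr_eq_zero

end Orthonormal

section Coherence

lemma tsum_range_le {α β : Type*} (φ : α → β) (f : β → ℝ≥0∞) :
    ∑' x : Set.range φ, f x ≤ ∑' a, f (φ a) :=
  ENNReal.tsum_le_tsum_comp_of_surjective Set.rangeFactorization_surjective
    fun x : Set.range φ => f x

variable {H : Type*} [NormedAddCommGroup H] [InnerProductSpace ℝ H] {A B : Set H}

lemma cumulativeCoherence_union_le {K : ℝ≥0∞}
    (hA : ∀ x ∈ A, ∑' y : A, ENNReal.ofReal |inner ℝ (y : H) x| ≤ K)
    (hB : Orthonormal ℝ ((↑) : B → H)) (hAB : ∀ x ∈ A, ∀ y ∈ B, inner ℝ x y = 0) :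
    cumulativeCoherence (A ∪ B) ≤ K := by
  refine iSup₂_le fun x hx => ?_
  by_cases hxB : x ∈ B
  · have inner_eq_zero : ∀ y ∈ A ∪ B, y ≠ x → inner ℝ y x = 0 := by
      rintro y (hy | hy) hyx
      · exact hAB y hy x hxB
      · exact hB.2 (i := ⟨y, hy⟩) (j := ⟨x, hxB⟩) (by simpa using hyx)
    refine (ENNReal.tsum_eq_zero.2 fun y => ?_).trans_le zero_le
    rw [inner_eq_zero y y.2.1 y.2.2, abs_zero, ENNReal.ofReal_zero]
  · have hxA : x ∈ A := hx.resolve_right hxB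
    refine le_trans ?_ (hA x hxA)
    refine (tsum_subtype {y | y ∈ A ∪ B ∧ y ≠ x} fun y => ENNReal.ofReal |inner ℝ y x|).trans_le ?_
    rw [tsum_subtype A fun y => ENNReal.ofReal |inner ℝ y x|]
    refine ENNReal.tsum_le_tsum fun y => Set.indicator_apply_le fun hy => ?_
    by_cases hyA : y ∈ A
    · rw [Set.indicator_of_mem hyA]
    · rw [real_inner_comm, hAB x hxA y (hy.1.resolve_left hyA), abs_zero, ENNReal.ofReal_zero]
      exact zero_le

end Coherence

section Spread

variable {ι H : Type*} [Fintype ι] [NormedAddCommGroup H] [InnerProductSpace ℝ H]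
  {r : ℝ} {a : ι → H} {u : H}

/-- The family obtained from `a` by replacing its component along `∑ j, a j` with one along `u`.
For `a` orthonormal, `u` a unit vector orthogonal to `a` and `r ^ 2 = card ι`, this is the
image of `a` under an isometry moving the unit vector `r⁻¹ • ∑ j, a j` to `u`. -/
noncomputable def spread (r : ℝ) (a : ι → H) (u : H) (i : ι) : H :=
  a i + r⁻¹ • (u - r⁻¹ • ∑ j, a j)

lemma inner_spread_of_orthogonal {x : H} (hx : ∀ j, inner ℝ (a j) x = 0) (i : ι) :
    inner ℝ (spread r a u i) x = r⁻¹ * inner ℝ u x := by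
  simp [spread, inner_add_left, inner_sub_left, real_inner_smul_left, sum_inner, hx]

lemma sum_spread (hr : r ≠ 0) (hcard : (Fintype.card ι : ℝ) = r ^ 2) :
    ∑ i, spread r a u i = r • u := by
  simp only [spread, Finset.sum_add_distrib, Finset.sum_const, Finset.card_univ,
    ← Nat.cast_smul_eq_nsmul ℝ, hcard, smul_sub, smul_smul]
  field_simp
  simp

lemma orthonormal_spread (ha : Orthonormal ℝ a) (hau : ∀ i, inner ℝ (a i) u = 0) (hu : ‖u‖ = 1)
    (hr : r ≠ 0) (hcard : (Fintype.card ι : ℝ) = r ^ 2) : Orthonormal ℝ (spread r a u) := by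
  classical
  have hua : ∀ i, inner ℝ u (a i) = 0 := fun i => by rw [real_inner_comm, hau]
  have huu : inner ℝ u u = (1 : ℝ) := by rw [real_inner_self_eq_norm_sq, hu, one_pow]
  rw [orthonormal_iff_ite] at ha ⊢
  intro i j
  simp only [spread, inner_add_left, inner_add_right, inner_sub_left, inner_sub_right,
    real_inner_smul_left, real_inner_smul_right, sum_inner, inner_sum, ha, hau, hua, huu,
    Finset.sum_ite_eq, Finset.sum_ite_eq', Finset.mem_univ, if_true, Finset.sum_const,
    Finset.card_univ, nsmul_eq_mul, hcard]
  field_simp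
  ring

end Spread

section LevelSystem

/-- The autocorrelations of the sequence `movingAverage e`. -/
noncomputable def autocorr : ℕ → ℝ
  | 0 => 1225 / 901
  | 1 => 630 / 901
  | 2 => 175 / 901
  | _ => 0

lemma abs_autocorr_succ_sub_lt (s : ℕ) :
    |autocorr (s + 1) - 18 / 35 * autocorr s| < (2 ^ (s + 1))⁻¹ := by
  rcases s with _ | _ | _ | s
  · norm_num [autocorr]
  · norm_num [autocorr, abs_of_nonneg, abs_of_nonpos]
  · norm_num [autocorr, abs_of_nonneg, abs_of_nonpos]
  · simp [autocorr]

lemma abs_autocorr_sub_le_one (s : ℕ) : |autocorr (s + 1) - 18 / 35 * autocorr (s + 2)| ≤ 1 := by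
  rcases s with _ | _ | s
  · norm_num [autocorr, abs_of_nonneg]
  · norm_num [autocorr, abs_of_nonneg]
  · simp [autocorr]

lemma abs_half_mul_autocorr_lt (s : ℕ) : |1 / 2 * autocorr s| < (2 ^ s)⁻¹ := by
  rcases s with _ | _ | _ | s
  · norm_num [autocorr, abs_of_nonneg]
  · norm_num [autocorr, abs_of_nonneg]
  · norm_num [autocorr, abs_of_nonneg]
  · simp [autocorr]

variable {H : Type*} [NormedAddCommGroup H] [InnerProductSpace ℝ H]

/-- The leading vectors of the construction, for an orthonormal sequence `e`. The weights `5, 3, 1`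
have correlations `35, 18, 5` at lags `0, 1, 2`. What matters is that `18 / 35` exceeds `1 / 2`; the
scalar factor gives `direction (18 / 35)` norm one. -/
noncomputable def movingAverage (e : ℕ → H) (m : ℕ) : H :=
  √(35 / 901) • ((5 : ℝ) • e m + (3 : ℝ) • e (m + 1) + e (m + 2))

lemma inner_movingAverage {e : ℕ → H} (he : Orthonormal ℝ e) (m s : ℕ) :
    inner ℝ (movingAverage e m) (movingAverage e (m + s)) = autocorr s := by
  rw [orthonormal_iff_ite] at he
  rw [movingAverage, movingAverage, real_inner_smul_left, real_inner_smul_right, ← mul_assoc,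
    Real.mul_self_sqrt (by norm_num)]
  simp only [inner_add_left, inner_add_right, real_inner_smul_left, real_inner_smul_right, he]
  rcases s with _ | _ | _ | s <;> simp [autocorr, add_assoc] <;> norm_num

/-- The raw material of the construction: leading vectors `w` with the prescribed
autocorrelations, an orthonormal family `a` orthogonal to them with `4 ^ l` members for each level
`l`, and one more unit vector `v` orthogonal to everything else. -/
structure IsLevelSystem (w : ℕ → H) (a : (Σ l : ℕ, Fin (4 ^ l)) → H) (v : H) : Prop where
  inner_leading : ∀ m s, inner ℝ (w m) (w (m + s)) = autocorr s
  orthonormal : Orthonormal ℝ a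
  inner_family_leading : ∀ p m, inner ℝ (a p) (w m) = 0
  norm_extra : ‖v‖ = 1
  inner_extra_leading : ∀ m, inner ℝ v (w m) = 0
  inner_extra_family : ∀ p, inner ℝ v (a p) = 0

lemma exists_isLevelSystem [CompleteSpace H] (hH : ¬ FiniteDimensional ℝ H) :
    ∃ (w : ℕ → H) (a : (Σ l : ℕ, Fin (4 ^ l)) → H) (v : H), IsLevelSystem w a v := by
  obtain ⟨b, hb⟩ := exists_orthonormal_of_not_finiteDimensional hH
    (ℕ ⊕ (Σ l : ℕ, Fin (4 ^ l)) ⊕ Unit)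
  have inner_movingAverage_eq_zero : ∀ i m,
      inner ℝ (b (.inr i)) (movingAverage (fun n => b (.inl n)) m) = 0 := fun i m => by
    simp [movingAverage, inner_add_right, real_inner_smul_right, orthonormal_iff_ite.1 hb]
  exact ⟨movingAverage fun n => b (.inl n), fun p => b (.inr (.inl p)), b (.inr (.inr ())),
    inner_movingAverage (hb.comp _ Sum.inl_injective),
    hb.comp _ (Sum.inr_injective.comp Sum.inl_injective),
    fun p => inner_movingAverage_eq_zero _, hb.1 _, inner_movingAverage_eq_zero _,
    fun p => hb.2 (by simp)⟩

/-- The dictionary elements of level `l`: the members of `a` at that level, rotated so that they sum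
to `2 ^ l • direction (18 / 35) w l`. -/
noncomputable def levelElement (w : ℕ → H) (a : (Σ l : ℕ, Fin (4 ^ l)) → H) (l : ℕ) :
    Fin (4 ^ l) → H :=
  spread (2 ^ l) (fun i => a ⟨l, i⟩) (direction (18 / 35) w l)

/-- A unit vector that puts `w 0` in the span of two dictionary elements, itself and `v`, neither
of which is greedily chosen. Here `2379 / 3604 = 1 - ‖w 0‖ ^ 2 / 4`. -/
noncomputable def pole (w : ℕ → H) (v : H) : H :=
  (1 / 2 : ℝ) • w 0 + √(2379 / 3604) • v

/-- The explicit part of the dictionary; the rest is an orthonormal set orthogonal to it, which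
serves only to make the span dense. -/
def core (w : ℕ → H) (a : (Σ l : ℕ, Fin (4 ^ l)) → H) (v : H) : Set H :=
  (Set.range fun p : Σ l : ℕ, Fin (4 ^ l) => levelElement w a p.1 p.2) ∪ {pole w v, v}

namespace IsLevelSystem

variable {w : ℕ → H} {a : (Σ l : ℕ, Fin (4 ^ l)) → H} {v : H} {k l m : ℕ}

lemma inner_leading_direction_self (h : IsLevelSystem w a v) (m : ℕ) :
    inner ℝ (w m) (direction (18 / 35) w m) = 1 := by
  have inner_self : inner ℝ (w m) (w m) = autocorr 0 := h.inner_leading m 0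
  rw [direction, inner_sub_right, real_inner_smul_right, h.inner_leading m 1, inner_self]
  norm_num [autocorr]

lemma inner_leading_direction_add (h : IsLevelSystem w a v) (m s : ℕ) :
    inner ℝ (w m) (direction (18 / 35) w (m + s + 1)) =
      autocorr (s + 1) - 18 / 35 * autocorr (s + 2) := by
  rw [direction, inner_sub_right, real_inner_smul_right, ← h.inner_leading m (s + 1),
    ← h.inner_leading m (s + 2)]
  rfl

lemma inner_leading_add_direction (h : IsLevelSystem w a v) (k s : ℕ) :
    inner ℝ (w (k + s + 1)) (direction (18 / 35) w k) =
      autocorr (s + 1) - 18 / 35 * autocorr s := by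
  rw [direction, inner_sub_right, real_inner_smul_right, real_inner_comm,
    real_inner_comm (w (k + 1)), ← h.inner_leading k (s + 1), ← h.inner_leading (k + 1) s,
    add_right_comm k 1 s]
  rfl

lemma inner_leading_direction_eq_zero (h : IsLevelSystem w a v) (hmk : m + 2 < k) :
    inner ℝ (w m) (direction (18 / 35) w k) = 0 := by
  obtain ⟨s, rfl⟩ := Nat.exists_eq_add_of_lt hmk
  rw [show m + 2 + s + 1 = m + (s + 2) + 1 by ring, h.inner_leading_direction_add]
  simp [autocorr]

lemma inv_two_pow_mul_abs_inner_lt (h : IsLevelSystem w a v) (hkm : k ≠ m) :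
    (2 ^ k : ℝ)⁻¹ * |inner ℝ (w m) (direction (18 / 35) w k)| < (2 ^ m)⁻¹ := by
  rcases hkm.lt_or_gt with hkm | hmk
  · obtain ⟨s, rfl⟩ := Nat.exists_eq_add_of_lt hkm
    rw [h.inner_leading_add_direction, add_assoc, pow_add, mul_inv]
    exact mul_lt_mul_of_pos_left (abs_autocorr_succ_sub_lt s) (by positivity)
  · obtain ⟨s, rfl⟩ := Nat.exists_eq_add_of_lt hmk
    rw [h.inner_leading_direction_add]
    calc (2 ^ (m + s + 1) : ℝ)⁻¹ * |autocorr (s + 1) - 18 / 35 * autocorr (s + 2)|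
        ≤ (2 ^ (m + s + 1))⁻¹ := mul_le_of_le_one_right (by positivity) (abs_autocorr_sub_le_one s)
      _ < (2 ^ m)⁻¹ := inv_strictAnti₀ (by positivity) (pow_lt_pow_right₀ one_lt_two (by omega))

lemma norm_direction (h : IsLevelSystem w a v) (l : ℕ) : ‖direction (18 / 35) w l‖ = 1 := by
  have inner_succ : inner ℝ (w (l + 1)) (direction (18 / 35) w l) = 0 := by
    rw [h.inner_leading_add_direction l 0]
    norm_num [autocorr]
  rw [← sq_eq_sq₀ (norm_nonneg _) zero_le_one, ← real_inner_self_eq_norm_sq]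
  nth_rw 1 [direction]
  rw [inner_sub_left, real_inner_smul_left, inner_succ, h.inner_leading_direction_self]
  norm_num

lemma inner_direction_direction_eq_zero (h : IsLevelSystem w a v) (hkl : k + 3 < l) :
    inner ℝ (direction (18 / 35) w l) (direction (18 / 35) w k) = 0 := by
  rw [real_inner_comm]
  nth_rw 1 [direction]
  rw [inner_sub_left, real_inner_smul_left, h.inner_leading_direction_eq_zero (by omega),
    h.inner_leading_direction_eq_zero (by omega), mul_zero, sub_zero]

lemma inner_family_direction (h : IsLevelSystem w a v) (p : Σ l : ℕ, Fin (4 ^ l)) (k : ℕ) :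
    inner ℝ (a p) (direction (18 / 35) w k) = 0 := by
  simp [direction, inner_sub_right, real_inner_smul_right, h.inner_family_leading]

lemma inner_extra_direction (h : IsLevelSystem w a v) (k : ℕ) :
    inner ℝ v (direction (18 / 35) w k) = 0 := by
  simp [direction, inner_sub_right, real_inner_smul_right, h.inner_extra_leading]

lemma inner_leading_pole (h : IsLevelSystem w a v) (m : ℕ) :
    inner ℝ (w m) (pole w v) = 1 / 2 * autocorr m := by
  rw [pole, inner_add_right, real_inner_smul_right, real_inner_smul_right, real_inner_comm,
    real_inner_comm v, h.inner_extra_leading, ← h.inner_leading 0 m, zero_add]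
  ring

lemma norm_pole (h : IsLevelSystem w a v) : ‖pole w v‖ = 1 := by
  rw [← sq_eq_sq₀ (norm_nonneg _) zero_le_one, ← real_inner_self_eq_norm_sq]
  nth_rw 1 [pole]
  rw [inner_add_left, real_inner_smul_left, real_inner_smul_left, h.inner_leading_pole, pole,
    inner_add_right, real_inner_smul_right, real_inner_smul_right, h.inner_extra_leading,
    real_inner_self_eq_norm_sq, h.norm_extra, mul_zero, zero_add, one_pow, mul_one,
    Real.mul_self_sqrt (by norm_num)]
  norm_num [autocorr]

lemma inner_family_levelElement (h : IsLevelSystem w a v) (hkl : k ≠ l) (j : Fin (4 ^ l))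
    (i : Fin (4 ^ k)) : inner ℝ (a ⟨l, j⟩) (levelElement w a k i) = 0 := by
  rw [real_inner_comm, levelElement, inner_spread_of_orthogonal fun i' =>
    h.orthonormal.2 fun heq => hkl (congrArg Sigma.fst heq),
    real_inner_comm, h.inner_family_direction, mul_zero]

lemma inner_family_pole (h : IsLevelSystem w a v) (p : Σ l : ℕ, Fin (4 ^ l)) :
    inner ℝ (a p) (pole w v) = 0 := by
  rw [pole, inner_add_right, real_inner_smul_right, real_inner_smul_right,
    h.inner_family_leading, real_inner_comm, h.inner_extra_family, mul_zero, mul_zero, add_zero]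

lemma inner_family_of_mem_core (h : IsLevelSystem w a v) {x : H} (hx : x ∈ core w a v)
    (hxl : x ∉ Set.range (levelElement w a l)) (j : Fin (4 ^ l)) : inner ℝ (a ⟨l, j⟩) x = 0 := by
  obtain ⟨⟨k, i⟩, rfl⟩ | rfl | rfl := hx
  · exact h.inner_family_levelElement (fun hkl => hxl (by subst hkl; exact ⟨i, rfl⟩)) j i
  · exact h.inner_family_pole _
  · rw [real_inner_comm, h.inner_extra_family]

lemma orthonormal_levelElement (h : IsLevelSystem w a v) (l : ℕ) :
    Orthonormal ℝ (levelElement w a l) :=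
  orthonormal_spread (h.orthonormal.comp _ sigma_mk_injective)
    (fun _ => h.inner_family_direction _ l) (h.norm_direction l) (by positivity)
    (by simp [four_pow_eq_two_pow_sq])

lemma inner_leading_levelElement (h : IsLevelSystem w a v) (m : ℕ) (i : Fin (4 ^ l)) :
    inner ℝ (w m) (levelElement w a l i) =
      (2 ^ l)⁻¹ * inner ℝ (w m) (direction (18 / 35) w l) := by
  rw [real_inner_comm, levelElement,
    inner_spread_of_orthogonal fun _ => h.inner_family_leading _ _, real_inner_comm]

end IsLevelSystem

lemma sum_levelElement (w : ℕ → H) (a : (Σ l : ℕ, Fin (4 ^ l)) → H) (l : ℕ) :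
    ∑ i, levelElement w a l i = (2 ^ l : ℝ) • direction (18 / 35) w l :=
  sum_spread (by positivity) (by simp [four_pow_eq_two_pow_sq])

lemma sum_abs_inner_levelElement_of_orthogonal (w : ℕ → H) {a : (Σ l : ℕ, Fin (4 ^ l)) → H}
    {l : ℕ} {x : H}
    (hx : ∀ j, inner ℝ (a ⟨l, j⟩) x = 0) :
    ∑ j, |inner ℝ (levelElement w a l j) x| = 2 ^ l * |inner ℝ (direction (18 / 35) w l) x| := by
  simp only [levelElement, inner_spread_of_orthogonal hx, abs_mul, abs_inv, Finset.sum_const,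
    Finset.card_univ, Fintype.card_fin, nsmul_eq_mul, abs_pow, Nat.abs_ofNat, Nat.cast_pow,
    Nat.cast_ofNat, four_pow_eq_two_pow_sq]
  field_simp

lemma direction_mem_span_core (w : ℕ → H) (a : (Σ l : ℕ, Fin (4 ^ l)) → H) (v : H) (l : ℕ) :
    direction (18 / 35) w l ∈ Submodule.span ℝ (core w a v) := by
  rw [← inv_smul_smul₀ (by positivity : (2 ^ l : ℝ) ≠ 0) (direction (18 / 35) w l),
    ← sum_levelElement w a l]
  exact Submodule.smul_mem _ _ <| Submodule.sum_mem _ fun i _ =>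
    Submodule.subset_span (Or.inl ⟨⟨l, i⟩, rfl⟩)

lemma leading_mem_span_core (w : ℕ → H) (a : (Σ l : ℕ, Fin (4 ^ l)) → H) (v : H) (m : ℕ) :
    w m ∈ Submodule.span ℝ (core w a v) := by
  induction m with
  | zero =>
    have : w 0 = (2 : ℝ) • (pole w v - √(2379 / 3604) • v) := by
      rw [pole, add_sub_cancel_right, smul_smul]
      norm_num
    rw [this]
    exact Submodule.smul_mem _ _ <| Submodule.sub_mem _
      (Submodule.subset_span (Or.inr (Or.inl rfl)))
      (Submodule.smul_mem _ _ (Submodule.subset_span (Or.inr (Or.inr rfl))))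
  | succ m ih =>
    have : w (m + 1) = (18 / 35 : ℝ)⁻¹ • (w m - direction (18 / 35) w m) := by
      rw [direction, sub_sub_cancel, inv_smul_smul₀ (by norm_num)]
    rw [this]
    exact Submodule.smul_mem _ _ (Submodule.sub_mem _ ih (direction_mem_span_core w a v m))

namespace IsLevelSystem

variable {w : ℕ → H} {a : (Σ l : ℕ, Fin (4 ^ l)) → H} {v : H} {B : Set H}

lemma abs_inner_leading_lt_of_mem_core (h : IsLevelSystem w a v) {l : ℕ} {x : H}
    (hx : x ∈ core w a v) (hxl : x ∉ Set.range (levelElement w a l)) :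
    |inner ℝ (w l) x| < (2 ^ l : ℝ)⁻¹ := by
  obtain ⟨⟨k, i⟩, rfl⟩ | rfl | rfl := hx
  · rw [h.inner_leading_levelElement, abs_mul, abs_of_pos (by positivity)]
    exact h.inv_two_pow_mul_abs_inner_lt fun hkl => hxl (by subst hkl; exact ⟨i, rfl⟩)
  · rw [h.inner_leading_pole]
    exact abs_half_mul_autocorr_lt l
  · rw [real_inner_comm, h.inner_extra_leading, abs_zero]
    positivity

lemma isGreedyCascade (h : IsLevelSystem w a v) (hB : ∀ x ∈ core w a v, ∀ y ∈ B, inner ℝ x y = 0) :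
    IsGreedyCascade (core w a v ∪ B) (18 / 35) w (levelElement w a) := by
  have inner_eq_zero : ∀ x ∈ Submodule.span ℝ (core w a v), ∀ y ∈ B, inner ℝ x y = 0 :=
    fun x hx y hy => Submodule.isOrtho_iff_inner_eq.1 (Submodule.isOrtho_span.2 hB) x hx y
      (Submodule.subset_span hy)
  have mem_core : ∀ l i, levelElement w a l i ∈ core w a v := fun l i => Or.inl ⟨⟨l, i⟩, rfl⟩
  refine ⟨by norm_num, by norm_num, fun l i => Or.inl (mem_core l i), h.orthonormal_levelElement,
    sum_levelElement w a, fun l i => ?_, fun l x hx hxl i => ?_, fun l x hx hxl => ?_⟩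
  · rw [h.inner_leading_levelElement, h.inner_leading_direction_self, mul_one]
  · obtain hx | hx := hx
    · exact inner_spread_of_orthogonal (h.inner_family_of_mem_core hx hxl) i
    · rw [hB _ (mem_core l i) x hx, inner_eq_zero _ (direction_mem_span_core w a v l) x hx,
        mul_zero]
  · obtain hx | hx := hx
    · exact h.abs_inner_leading_lt_of_mem_core hx hxl
    · rw [inner_eq_zero _ (leading_mem_span_core w a v l) x hx, abs_zero]
      positivity

lemma norm_eq_one_of_mem_core (h : IsLevelSystem w a v) {x : H} (hx : x ∈ core w a v) :
    ‖x‖ = 1 := by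
  obtain ⟨⟨l, i⟩, rfl⟩ | rfl | rfl := hx
  · exact (h.orthonormal_levelElement l).1 i
  · exact h.norm_pole
  · exact h.norm_extra

lemma abs_inner_direction_levelElement_le (h : IsLevelSystem w a v) (l k : ℕ) (i : Fin (4 ^ k)) :
    |inner ℝ (direction (18 / 35) w l) (levelElement w a k i)| ≤
      if l < k + 4 then (2 ^ k)⁻¹ else 0 := by
  rw [real_inner_comm, levelElement,
    inner_spread_of_orthogonal fun _ => h.inner_family_direction _ _, real_inner_comm, abs_mul,
    abs_of_pos (by positivity)]
  split_ifs with hlk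
  · refine mul_le_of_le_one_right (by positivity) ?_
    simpa [h.norm_direction] using
      abs_real_inner_le_norm (direction (18 / 35) w l) (direction (18 / 35) w k)
  · rw [h.inner_direction_direction_eq_zero (by omega), abs_zero, mul_zero]

lemma abs_inner_direction_pole_le (h : IsLevelSystem w a v) (l : ℕ) :
    |inner ℝ (direction (18 / 35) w l) (pole w v)| ≤ if l < 4 then 1 else 0 := by
  split_ifs with hl
  · simpa [h.norm_direction, h.norm_pole] using
      abs_real_inner_le_norm (direction (18 / 35) w l) (pole w v)
  · rw [pole, inner_add_right, real_inner_smul_right, real_inner_smul_right, real_inner_comm,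
      real_inner_comm v, h.inner_extra_direction, h.inner_leading_direction_eq_zero (by omega)]
    simp

-- The level sums grow like `2 ^ l`, but only up to `l = k + 3`, because directions more than three
-- levels apart are orthogonal; `pole w v` and `v` behave like elements of level `0`.
lemma exists_sum_abs_inner_levelElement_le (h : IsLevelSystem w a v) {x : H}
    (hx : x ∈ core w a v) :
    ∃ k : ℕ, ∀ l, ∑ j, |inner ℝ (levelElement w a l j) x| ≤
      if l < k + 4 then 2 ^ l / 2 ^ k else 0 := by
  obtain ⟨⟨k, i⟩, rfl⟩ | rfl | rfl := hx
  · refine ⟨k, fun l => ?_⟩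
    obtain rfl | hkl := eq_or_ne k l
    · simp [orthonormal_iff_ite.1 (h.orthonormal_levelElement k), apply_ite]
    · rw [sum_abs_inner_levelElement_of_orthogonal w fun j => h.inner_family_levelElement hkl j i]
      refine (mul_le_mul_of_nonneg_left (h.abs_inner_direction_levelElement_le l k i)
        (by positivity)).trans_eq ?_
      rw [mul_ite, mul_zero, div_eq_mul_inv]
  · refine ⟨0, fun l => ?_⟩
    rw [sum_abs_inner_levelElement_of_orthogonal w fun j => h.inner_family_pole _]
    refine (mul_le_mul_of_nonneg_left (h.abs_inner_direction_pole_le l) (by positivity)).trans_eq ?_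
    simp
  · refine ⟨0, fun l => ?_⟩
    rw [sum_abs_inner_levelElement_of_orthogonal w fun j => by
      rw [real_inner_comm, h.inner_extra_family], real_inner_comm, h.inner_extra_direction]
    simp only [abs_zero, mul_zero]
    positivity

lemma tsum_abs_inner_levelElement_le (h : IsLevelSystem w a v) {x : H} (hx : x ∈ core w a v) :
    ∑' p : Σ l : ℕ, Fin (4 ^ l), ENNReal.ofReal |inner ℝ (levelElement w a p.1 p.2) x| ≤ 16 := by
  obtain ⟨k, hk⟩ := h.exists_sum_abs_inner_levelElement_le hx
  have level_le : ∀ l, ∑ j, ENNReal.ofReal |inner ℝ (levelElement w a l j) x| ≤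
      ENNReal.ofReal (if l < k + 4 then 2 ^ l / 2 ^ k else 0) := fun l => by
    rw [← ENNReal.ofReal_sum_of_nonneg fun _ _ => abs_nonneg _]
    exact ENNReal.ofReal_le_ofReal (hk l)
  have geometric : ∑ l ∈ Finset.range (k + 4), (2 ^ l / 2 ^ k : ℝ) ≤ 16 := by
    rw [← Finset.sum_div, div_le_iff₀ (by positivity), geom_sum_eq (by norm_num), pow_add]
    linarith
  rw [ENNReal.tsum_sigma' fun p : Σ l : ℕ, Fin (4 ^ l) =>
    ENNReal.ofReal |inner ℝ (levelElement w a p.1 p.2) x|]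
  calc ∑' l, ∑' j, ENNReal.ofReal |inner ℝ (levelElement w a l j) x|
      ≤ ∑' l, ENNReal.ofReal (if l < k + 4 then 2 ^ l / 2 ^ k else 0) :=
        ENNReal.tsum_le_tsum fun l => by rw [tsum_fintype]; exact level_le l
    _ = ∑ l ∈ Finset.range (k + 4), ENNReal.ofReal (2 ^ l / 2 ^ k) := by
        rw [tsum_eq_sum (s := Finset.range (k + 4)) fun l hl => by
          rw [if_neg (mt Finset.mem_range.2 hl), ENNReal.ofReal_zero]]
        exact Finset.sum_congr rfl fun l hl => by rw [if_pos (Finset.mem_range.1 hl)]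
    _ ≤ ENNReal.ofReal 16 := by
        rw [← ENNReal.ofReal_sum_of_nonneg fun _ _ => by positivity]
        exact ENNReal.ofReal_le_ofReal geometric
    _ = 16 := ENNReal.ofReal_ofNat 16

lemma tsum_abs_inner_core_le (h : IsLevelSystem w a v) {x : H} (hx : x ∈ core w a v) :
    ∑' y : core w a v, ENNReal.ofReal |inner ℝ (y : H) x| ≤ 18 := by
  have single_le : ∀ z ∈ core w a v,
      ∑' y : ({z} : Set H), ENNReal.ofReal |inner ℝ (y : H) x| ≤ 1 := fun z hz => by
    rw [tsum_singleton z fun y => ENNReal.ofReal |inner ℝ y x|, ENNReal.ofReal_le_one]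
    simpa [h.norm_eq_one_of_mem_core hz, h.norm_eq_one_of_mem_core hx] using
      abs_real_inner_le_norm z x
  calc ∑' y : core w a v, ENNReal.ofReal |inner ℝ (y : H) x|
      ≤ (∑' p : Σ l : ℕ, Fin (4 ^ l), ENNReal.ofReal |inner ℝ (levelElement w a p.1 p.2) x|) +
        ((∑' y : ({pole w v} : Set H), ENNReal.ofReal |inner ℝ (y : H) x|) +
          ∑' y : ({v} : Set H), ENNReal.ofReal |inner ℝ (y : H) x|) :=
        (ENNReal.tsum_union_le (fun y => ENNReal.ofReal |inner ℝ y x|) _ _).trans <|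
          add_le_add (tsum_range_le _ fun y => ENNReal.ofReal |inner ℝ y x|)
            (ENNReal.tsum_union_le (fun y => ENNReal.ofReal |inner ℝ y x|) _ _)
    _ ≤ 16 + (1 + 1) := add_le_add (h.tsum_abs_inner_levelElement_le hx) <|
        add_le_add (single_le _ (Or.inr (Or.inl rfl))) (single_le _ (Or.inr (Or.inr rfl)))
    _ = 18 := by norm_num

end IsLevelSystem

end LevelSystem

theorem theorem3_general {H : Type*} [NormedAddCommGroup H] [InnerProductSpace ℝ H]
    [CompleteSpace H] (hH : ¬ FiniteDimensional ℝ H) :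
    ∃ (D : Set H) (f₀ : H) (β C : ℝ),
      IsDictionary D ∧ cumulativeCoherence D < ⊤ ∧ f₀ ∈ finiteCombinations D ∧
      0 < β ∧ 0 < C ∧
      (∃ g : ℕ → H, IsPGASelection D f₀ g) ∧
      ∀ g : ℕ → H, IsPGASelection D f₀ g →
        ∀ m : ℕ, 1 ≤ m → C * (m : ℝ) ^ (-(1 / 2 : ℝ) + β) ≤ ‖f₀ - pgaApprox f₀ g m‖ := by
  obtain ⟨w, a, v, h⟩ := exists_isLevelSystem hH
  obtain ⟨B, hB, hAB, dense⟩ := exists_orthonormal_completion (𝕜 := ℝ) (core w a v)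
  have cascade := h.isGreedyCascade hAB
  refine ⟨core w a v ∪ B, w 0, 1 / 2 + Real.logb 4 (18 / 35), (18 / 35) ^ 2,
    ⟨?_, dense⟩, ?_, ?_, ?_, by norm_num, cascade.exists_isPGASelection, fun g hg m hm => ?_⟩
  · rintro x (hx | hx)
    exacts [h.norm_eq_one_of_mem_core hx, hB.1 ⟨x, hx⟩]
  · exact (cumulativeCoherence_union_le (fun x hx => h.tsum_abs_inner_core_le hx) hB hAB).trans_lt
      (ENNReal.ofNat_lt_top (n := 18))
  · exact Submodule.span_mono Set.subset_union_left (leading_mem_span_core w a v 0)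
  · linarith [neg_half_lt_logb_four (ρ := 18 / 35) (by norm_num)]
  · rw [neg_add_cancel_left]
    exact cascade.rpow_le_norm_sub_pgaApprox hg hm

theorem theorem3 {H : Type*} [NormedAddCommGroup H] [InnerProductSpace ℝ H] [CompleteSpace H]
    [TopologicalSpace.SeparableSpace H] (hH : ¬ FiniteDimensional ℝ H) :
    ∃ (D : Set H) (f₀ : H) (β C : ℝ),
      IsDictionary D ∧ cumulativeCoherence D < ⊤ ∧ f₀ ∈ finiteCombinations D ∧
      0 < β ∧ 0 < C ∧
      (∃ g : ℕ → H, IsPGASelection D f₀ g) ∧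
      ∀ g : ℕ → H, IsPGASelection D f₀ g →
        ∀ m : ℕ, 1 ≤ m → C * (m : ℝ) ^ (-(1 / 2 : ℝ) + β) ≤ ‖f₀ - pgaApprox f₀ g m‖ :=
  theorem3_general hH
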